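/- Let $\mathbb T=\mathbb R/\mathbb Z$ and let $V,b\in C^\infty(\mathbb T;\mathbb R)$ with $\int_{\mathbb T}b\,dx=0$. Consider the stationary mean field game of finding $u,m\in C^\infty(\mathbb T)$, $m>0$, and $\overline H\in\mathbb R$ with $$\tfrac{u_x^2}{2}+V+b\,u_x=\ln m+\overline H,\qquad -(m(u_x+b))_x=0\quad\text{on }\mathbb T,\qquad \int_{\mathbb T}m\,dx=1,\quad \int_{\mathbb T}u\,dx=0. \tag{1}$$ Let $\mathcal U\subset C^2(\mathbb T)$ and $\mathcal V\subset C^1(\mathbb T)$ be reproducing kernel Hilbert spaces of real functions on $\mathbb T$ that are compactly embedded in $H^{s_1}(\mathbb T)$ and $H^{s_2}(\mathbb T)$ respectively, with $s_1>3$ and $s_2>2$, and let $(u^*,m^*,\overline H^*)$ be a solution of (1) with $u^*\in\mathcal U$, $m^*\in\mathcal V$. For each $M\in\mathbb N$ let $x_1,\dots,x_M\in\mathbb T$ be distinct points (which may depend on $M$), such that, as $M\to\infty$, $$\sup_{x\in\mathbb T}\min_{1\le i\le M}|x-x_i|\to0,\qquad \frac1M\sum_{i=1}^M u^*(x_i)\to\int_{\mathbb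 T}u^*\,dx,\qquad \frac1M\sum_{i=1}^M m^*(x_i)\to\int_{\mathbb T}m^*\,dx$$ (the last two conditions hold, for example, if the points are asymptotically uniformly distributed). For $M\in\mathbb N$ and $\beta>0$ consider the problem of minimizing $$\|u\|_{\mathcal U}^2+\|m\|_{\mathcal V}^2+|\overline H|^2+\beta\Big|\frac1M\sum_{i=1}^M m(x_i)-1\Big|^2+\beta\Big|\frac1M\sum_{i=1}^M u(x_i)\Big|^2$$ over all $(u,m,\overline H)\in\mathcal U\times\mathcal V\times\mathbb R$ such that, for $i=1,\dots,M$, $m(x_i)>0$ and $$\tfrac{u_x(x_i)^2}{2}+V(x_i)+b(x_i)u_x(x_i)=\ln m(x_i)+\overline H,\qquad m_x(x_i)\big(u_x(x_i)+b(x_i)\big)+m(x_i)\big(u_{xx}(x_i)+b_x(x_i)\big)=0 .$$ Then $(u^*,m^*,\overline H^*)$ is given by $$u^*(x)=-\int_0^x b\,dy+\int_0^1\!\int_0^z b\,dy\,dz,\qquad m^*=\frac{e^{V-b^2/2}}{\int_{\mathbb T}e^{V-b^2/2}\,dy},\qquad \overline H^*=\ln\int_{\mathbb T}e^{V-b^2/2}\,dy,$$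 and minimizers converge to it along suitable sequences $(M_p,\beta_p)$ with $M_p,\beta_p\to\infty$. More precisely, for every sequence $\beta_p>0$ with $\beta_p\to\infty$ there are numbers $N_p\in\mathbb N$ such that, whenever $M_p\ge N_p$ for all $p$ and $(u_p,m_p,\overline H_p)$ is any minimizer of the problem with $M=M_p$ and $\beta=\beta_p$, the functions $u_p\to u^*$ and $m_p\to m^*$ pointwise on $\mathbb T$, $\overline H_p\to\overline H^*$, and $(u_p,m_p,\overline H_p)\to(u^*,m^*,\overline H^*)$ in $H^{t_1}(\mathbb T)\times H^{t_2}(\mathbb T)\times\mathbb R$ for all $t_1\in(3,s_1)$ and $t_2\in(2,s_2)$. -/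

import Mathlib

open Filter Topology MeasureTheory
open scoped ContDiff

noncomputable section

namespace MFG

/-- The one-dimensional torus `ℝ / ℤ`. -/
abbrev Torus : Type := UnitAddCircle

/-- The 1-periodic function on the line that represents a function on the torus. -/
def periodicLift (f : Torus → ℝ) : ℝ → ℝ := fun t => f (t : Torus)

/-- `f` belongs to `C^n(𝕋)`. -/
def IsCk (n : WithTop ℕ∞) (f : Torus → ℝ) : Prop := ContDiff ℝ n (periodicLift f)

/-- The derivative `f_x` of a function on the torus. -/
def dx (f : Torus → ℝ) : Torus → ℝ := fun x => deriv (fun t : ℝ => f (x + (t : Torus))) 0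

/-- The terms `(1 + n²)^s |f̂(n)|²` of the squared `H^s(𝕋)` norm, where `f̂(n)` is the `n`-th Fourier
coefficient of `f`. -/
def sobolevTerm (s : ℝ) (f : Torus → ℝ) (n : ℤ) : ℝ :=
  (1 + (n : ℝ) ^ 2) ^ s * ‖fourierCoeff (fun x : Torus => (f x : ℂ)) n‖ ^ 2

/-- `f` belongs to the Sobolev space `H^s(𝕋)`, for real `s ≥ 0`. -/
def MemSobolev (s : ℝ) (f : Torus → ℝ) : Prop :=
  MemLp f 2 (volume : Measure Torus) ∧ Summable (sobolevTerm s f)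

/-- The norm of `H^s(𝕋)` (of interest for members of `H^s(𝕋)` only). -/
def sobolevNorm (s : ℝ) (f : Torus → ℝ) : ℝ := √(∑' n : ℤ, sobolevTerm s f n)

/-- `f k → g` in `H^s(𝕋)`. -/
def TendstoSobolev (s : ℝ) (f : ℕ → Torus → ℝ) (g : Torus → ℝ) : Prop :=
  (∀ k, MemSobolev s (f k)) ∧ MemSobolev s g ∧
    Tendsto (fun k => sobolevNorm s (fun x => f k x - g x)) atTop (𝓝 0)

/-- The compact embedding `U ⊂⊂ H^s(𝕋)`: `U` is contained in `H^s(𝕋)`, and each bounded sequence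
of `U` has a subsequence that converges in `H^s(𝕋)`. -/
def CompactlyEmbedded (U : Type*) [NormedAddCommGroup U] [InnerProductSpace ℝ U]
    [RKHS ℝ U Torus ℝ] (s : ℝ) : Prop :=
  (∀ f : U, MemSobolev s f) ∧
    ∀ f : ℕ → U, (∃ C : ℝ, ∀ k, ‖f k‖ ≤ C) →
      ∃ (g : Torus → ℝ) (φ : ℕ → ℕ), StrictMono φ ∧ TendstoSobolev s (fun k => ⇑(f (φ k))) g

/-- The Hamiltonian `H(x, p) = V(x) + p²/2 + b(x) p`. -/
def hamiltonian (V b : Torus → ℝ) (x : Torus) (p : ℝ) : ℝ := V x + p ^ 2 / 2 + b x * p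

/-- `(u, m, H)` is a smooth solution of the stationary mean field game on the torus. -/
structure IsMFGSolution (V b u m : Torus → ℝ) (H : ℝ) : Prop where
  smooth_u : IsCk ∞ u
  smooth_m : IsCk ∞ m
  /-- The equation with `ln m` presupposes a positive density. -/
  pos : ∀ x, 0 < m x
  hamilton_jacobi : ∀ x, dx u x ^ 2 / 2 + V x + b x * dx u x = Real.log (m x) + H
  continuity : ∀ x, -dx (fun y => m y * (dx u y + b y)) x = 0
  mass : ∫ x : Torus, m x = 1
  mean : ∫ x : Torus, u x = 0

/-- The average of `f` over the sample points. -/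
def sampleMean {M : ℕ} (X : Fin M → Torus) (f : Torus → ℝ) : ℝ := (1 / (M : ℝ)) * ∑ i, f (X i)

/-- The fill distance `sup_x min_i |x - x_i|` of the sample points. -/
def fillDistance {M : ℕ} (X : Fin M → Torus) : ℝ := ⨆ x : Torus, ⨅ i : Fin M, dist x (X i)

section GP

variable (U W : Type*) [NormedAddCommGroup U] [InnerProductSpace ℝ U] [RKHS ℝ U Torus ℝ]
  [NormedAddCommGroup W] [InnerProductSpace ℝ W] [RKHS ℝ W Torus ℝ]

/-- The constraints of the optimal recovery problem: the mean field game holds at the samples. -/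
def gpFeasible (V b : Torus → ℝ) {M : ℕ} (X : Fin M → Torus) : Set (U × W × ℝ) :=
  {q | ∀ i : Fin M,
    0 < q.2.1 (X i) ∧
    hamiltonian V b (X i) (dx q.1 (X i)) = Real.log (q.2.1 (X i)) + q.2.2 ∧
    dx q.2.1 (X i) * (dx q.1 (X i) + b (X i)) +
      q.2.1 (X i) * (dx (dx q.1) (X i) + dx b (X i)) = 0}

/-- The objective of the optimal recovery problem with penalization parameter `β`. -/
def gpObjective {M : ℕ} (X : Fin M → Torus) (β : ℝ) (q : U × W × ℝ) : ℝ :=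
  ‖q.1‖ ^ 2 + ‖q.2.1‖ ^ 2 + |q.2.2| ^ 2
    + β * |sampleMean X q.2.1 - 1| ^ 2 + β * |sampleMean X q.1| ^ 2

variable {U W}

/-- `q = (u, m, H)` minimizes the objective subject to the constraints. -/
def IsGPMinimizer (V b : Torus → ℝ) {M : ℕ} (X : Fin M → Torus) (β : ℝ) (q : U × W × ℝ) : Prop :=
  q ∈ gpFeasible U W V b X ∧ IsMinOn (gpObjective U W X β) (gpFeasible U W V b X) q

end GP

end MFG

end

/-! The game decouples. The flux `m (u_x + b)` is constant, and `u_x + b` has mean zero by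
periodicity and `∫ b = 0`, so it vanishes somewhere. Hence the flux is zero and, as `m > 0`, `u_x =
-b`. The Hamilton-Jacobi equation then gives `m = exp (V - b²/2 - H)`; the mass fixes `H` and the
mean of `u` its additive constant. `eq_neg_of_hasDerivAt_flux_zero` states the first step under weak
regularity, so that it serves both for the smooth solution and for limits of minimizers.

For the convergence, the solution is feasible for every `M`. Once `M_p` is large in terms of `β_p`,
both penalties of the solution are at most 1, so the minimal values are bounded by a constant `K²`.
Thus minimizers are bounded in `U × W × ℝ`, and the squared errors of their sample means are at most
`K² / β_p` (`IsGPMinimizer.bounds`). Compact embedding and the Sobolev inequality give subsequences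
converging in `C² × C¹ × ℝ`. Every point of the torus is a limit of sample points, so the limit
solves the equations everywhere. By the rigidity above it is the solution up to an additive constant
in `u` and a factor in `m`, which the sample means fix (`IsMFGSolution.eq_of_tendsto`). The limit
does not depend on the subsequence, so the whole sequence converges. -/

namespace MFG

/-! ### Derivatives and Fourier coefficients on the torus -/

variable {f g : Torus → ℝ}

lemma dx_coe (f : Torus → ℝ) (t : ℝ) : dx f (t : Torus) = deriv (periodicLift f) t := by
  simp only [dx, ← AddCircle.coe_add]
  simpa [periodicLift] using deriv_comp_const_add (periodicLift f) t 0

lemma periodicLift_dx (f : Torus → ℝ) : periodicLift (dx f) = deriv (periodicLift f) :=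
  funext fun t => dx_coe f t

lemma periodic_periodicLift (f : Torus → ℝ) : Function.Periodic (periodicLift f) 1 := fun t => by
  simp [periodicLift]

lemma IsCk.continuous {n : WithTop ℕ∞} (hf : IsCk n f) : Continuous f :=
  continuous_coinduced_dom.mpr (ContDiff.continuous hf)

lemma IsCk.hasDerivAt {n : WithTop ℕ∞} (hf : IsCk n f) (hn : n ≠ 0) (t : ℝ) :
    HasDerivAt (periodicLift f) (dx f (t : Torus)) t := by
  rw [dx_coe]
  exact (hf.differentiable hn t).hasDerivAt

lemma IsCk.dx {n k : WithTop ℕ∞} (hf : IsCk n f) (hk : k + 1 ≤ n) : IsCk k (dx f) := by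
  rw [IsCk, periodicLift_dx]
  exact ((contDiff_succ_iff_deriv (n := k)).1 (ContDiff.of_le hf hk)).2.2

lemma dx_eq_of_hasDerivAt {t d : ℝ} (h : HasDerivAt (periodicLift f) d t) :
    dx f (t : Torus) = d := by
  rw [dx_coe, h.deriv]

lemma dx_sub {n : WithTop ℕ∞} (hf : IsCk n f) (hg : IsCk n g) (hn : n ≠ 0) :
    dx (f - g) = dx f - dx g := by
  ext x
  induction x using QuotientAddGroup.induction_on with
  | H t => exact dx_eq_of_hasDerivAt ((hf.hasDerivAt hn t).sub (hg.hasDerivAt hn t))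

lemma IsCk.sub {n : WithTop ℕ∞} (hf : IsCk n f) (hg : IsCk n g) : IsCk n (f - g) :=
  ContDiff.sub hf hg

/-- The Fourier coefficients of a real function. -/
noncomputable abbrev coeff (f : Torus → ℝ) (n : ℤ) : ℂ := fourierCoeff (fun x : Torus => (f x : ℂ)) n

lemma coeff_dx (hf : IsCk 1 f) (n : ℤ) :
    coeff (MFG.dx f) n = 2 * Real.pi * Complex.I * n * coeff f n := by
  have hd : Continuous (MFG.dx f) := (hf.dx (k := 0) (by simp)).continuous
  rw [coeff, coeff, fourierCoeff_eq_intervalIntegral _ _ 0, fourierCoeff_eq_intervalIntegral _ _ 0]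
  simp only [smul_eq_mul, zero_add, div_one, one_smul]
  have hA : ∀ x ∈ Set.uIcc (0 : ℝ) 1, HasDerivAt (fun t : ℝ => (fourier (-n) (t : Torus) : ℂ))
      (-2 * Real.pi * Complex.I * n / (1 : ℝ) * fourier (-n) (x : Torus)) x := fun x _ =>
    hasDerivAt_fourier_neg 1 n x
  have hB : ∀ x ∈ Set.uIcc (0 : ℝ) 1, HasDerivAt (fun t : ℝ => (f (t : Torus) : ℂ))
      (MFG.dx f (x : Torus) : ℂ) x := fun x _ => (hf.hasDerivAt one_ne_zero x).ofReal_comp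
  have hc : Continuous fun x : ℝ => (x : Torus) := AddCircle.continuous_mk' _
  have hF : Continuous fun x : ℝ => (fourier (-n) (x : Torus) : ℂ) :=
    (map_continuous (fourier (-n))).comp hc
  rw [intervalIntegral.integral_mul_deriv_eq_deriv_mul hA hB
    ((continuous_const.mul hF).intervalIntegrable _ _)
    ((Complex.continuous_ofReal.comp (hd.comp hc)).intervalIntegrable _ _)]
  -- The boundary terms of the integration by parts cancel by periodicity.
  have h1 : ((1 : ℝ) : Torus) = ((0 : ℝ) : Torus) := by
    simp
  rw [h1, sub_self, zero_sub, ← intervalIntegral.integral_neg,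
    ← intervalIntegral.integral_const_mul]
  refine intervalIntegral.integral_congr fun x _ => ?_
  simp only [Complex.ofReal_one, div_one]
  ring

lemma volume_eq_haarAddCircle :
    (volume : Measure Torus) = AddCircle.haarAddCircle := by
  simp [AddCircle.volume_eq_smul_haarAddCircle]

lemma coeff_sub (hf : Integrable f) (hg : Integrable g) (n : ℤ) :
    coeff (f - g) n = coeff f n - coeff g n := by
  rw [volume_eq_haarAddCircle] at hf hg
  have h1 := (hf.ofReal (𝕜 := ℂ)).fourier_smul (-n)
  have h2 := (hg.ofReal (𝕜 := ℂ)).fourier_smul (-n)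
  refine Eq.trans (integral_congr_ae (ae_of_all _ fun x => ?_)) (integral_sub h1 h2)
  simp [mul_sub]

lemma norm_coeff_le {C : ℝ} (h : ∀ x, |f x| ≤ C) (n : ℤ) : ‖coeff f n‖ ≤ C := by
  rw [coeff, fourierCoeff]
  refine (norm_integral_le_of_norm_le_const (C := C) (ae_of_all _ fun x => ?_)).trans (by simp)
  rw [norm_smul, fourier_apply, Circle.norm_coe, one_mul, Complex.norm_real]
  exact h x

end MFG

/-! ### Sobolev norms and Sobolev inequalities -/

namespace MFG

variable {f g : Torus → ℝ} {s t : ℝ}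

lemma one_add_sq_pos (n : ℤ) : (0 : ℝ) < 1 + (n : ℝ) ^ 2 := by positivity

lemma sobolevTerm_nonneg (s : ℝ) (f : Torus → ℝ) (n : ℤ) : 0 ≤ sobolevTerm s f n := by
  unfold sobolevTerm; positivity

lemma sobolevNorm_nonneg (s : ℝ) (f : Torus → ℝ) : 0 ≤ sobolevNorm s f := Real.sqrt_nonneg _

lemma summable_one_add_sq_rpow_neg (hs : 1 < s) :
    Summable fun n : ℤ => (1 + (n : ℝ) ^ 2) ^ (-s) := by
  have h := (Real.summable_one_div_int_pow (p := 2)).2 one_lt_two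
  refine Summable.of_norm_bounded_eventually h ?_
  filter_upwards [(Set.finite_singleton (0 : ℤ)).compl_mem_cofinite] with n hn
  have hn : (n : ℝ) ≠ 0 := by simpa using hn
  rw [Real.norm_of_nonneg (by positivity)]
  calc (1 + (n : ℝ) ^ 2) ^ (-s) ≤ (1 + (n : ℝ) ^ 2) ^ (-1 : ℝ) :=
        Real.rpow_le_rpow_of_exponent_le (by nlinarith [sq_nonneg (n : ℝ)]) (by linarith)
    _ = 1 / (1 + (n : ℝ) ^ 2) := by rw [Real.rpow_neg_one, one_div]
    _ ≤ 1 / (n : ℝ) ^ 2 := one_div_le_one_div_of_le (by positivity) (by linarith)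

/-- The Sobolev inequality `sup |f| ≤ C ‖f‖_{H^s}`. -/
lemma exists_abs_le_sobolevNorm (hs : 1 < s) :
    ∃ C : ℝ, 0 ≤ C ∧ ∀ f : Torus → ℝ, Continuous f → Summable (sobolevTerm s f) →
      ∀ x, |f x| ≤ C * sobolevNorm s f := by
  refine ⟨(∑' n : ℤ, (1 + (n : ℝ) ^ 2) ^ (-s)) ^ (1 / 2 : ℝ), by positivity,
    fun f hf hsum x => ?_⟩
  -- Cauchy-Schwarz with the weights `(1 + n²)^(∓s/2)` makes the Fourier coefficients absolutely
  -- summable, so the Fourier series of the continuous `f` converges to it at every point.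
  set a : ℤ → ℝ := fun n => (1 + (n : ℝ) ^ 2) ^ (-s / 2)
  set c : ℤ → ℝ := fun n => (1 + (n : ℝ) ^ 2) ^ (s / 2) * ‖coeff f n‖
  have ha : ∀ n, a n ^ (2 : ℝ) = (1 + (n : ℝ) ^ 2) ^ (-s) := fun n => by
    rw [← Real.rpow_mul (one_add_sq_pos n).le]; congr 1; ring
  have hc : ∀ n, c n ^ (2 : ℝ) = sobolevTerm s f n := fun n => by
    rw [Real.mul_rpow (by positivity) (by positivity), ← Real.rpow_mul (one_add_sq_pos n).le,
      Real.rpow_two, sobolevTerm]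
    congr 2; ring
  have hac : ∀ n, a n * c n = ‖coeff f n‖ := fun n => by
    rw [← mul_assoc, ← Real.rpow_add (one_add_sq_pos n)]
    simp [neg_div]
  obtain ⟨h1, h2⟩ := Real.summable_and_inner_le_Lp_mul_Lq_tsum_of_nonneg
    (f := a) (g := c) (Real.HolderConjugate.two_two) (fun n => by positivity)
    (fun n => by positivity)
    (by simpa only [ha] using summable_one_add_sq_rpow_neg hs) (by simpa only [hc] using hsum)
  simp only [ha, hc, hac] at h1 h2
  have h3 := has_pointwise_sum_fourier_series_of_summable (T := 1)
    (f := ⟨fun x => (f x : ℂ), Complex.continuous_ofReal.comp hf⟩) h1.of_norm x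
  have h4 : |f x| ≤ ∑' n, ‖coeff f n‖ := by
    have h5 : ∀ n : ℤ, ‖coeff f n • (fourier n x : ℂ)‖ = ‖coeff f n‖ := fun n => by
      rw [norm_smul, fourier_apply, Circle.norm_coe, mul_one]
    have h6 : (f x : ℂ) = ∑' n : ℤ, coeff f n • (fourier n x : ℂ) := h3.tsum_eq.symm
    rw [← Real.norm_eq_abs, ← Complex.norm_real, h6]
    refine (norm_tsum_le_tsum_norm ?_).trans_eq (tsum_congr h5)
    simpa only [h5] using h1
  refine h4.trans (h2.trans_eq ?_)
  rw [sobolevNorm, Real.sqrt_eq_rpow]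

lemma sobolevTerm_mono (hst : t ≤ s) (f : Torus → ℝ) (n : ℤ) :
    sobolevTerm t f n ≤ sobolevTerm s f n :=
  mul_le_mul_of_nonneg_right
    (Real.rpow_le_rpow_of_exponent_le (by nlinarith [sq_nonneg (n : ℝ)]) hst) (by positivity)

lemma MemSobolev.mono (hf : MemSobolev s f) (hst : t ≤ s) : MemSobolev t f :=
  ⟨hf.1, hf.2.of_nonneg_of_le (sobolevTerm_nonneg t f) (sobolevTerm_mono hst f)⟩

lemma MemSobolev.sobolevNorm_mono (hf : MemSobolev s f) (hst : t ≤ s) :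
    sobolevNorm t f ≤ sobolevNorm s f :=
  Real.sqrt_le_sqrt ((hf.mono hst).2.tsum_le_tsum (sobolevTerm_mono hst f) hf.2)

lemma MemSobolev.integrable (hf : MemSobolev s f) : Integrable f := hf.1.integrable one_le_two

lemma MemSobolev.sobolevTerm_sub_le (hf : MemSobolev s f) (hg : MemSobolev s g) (n : ℤ) :
    sobolevTerm s (f - g) n ≤ 2 * sobolevTerm s f n + 2 * sobolevTerm s g n := by
  have h : ‖coeff (f - g) n‖ ^ 2 ≤ 2 * ‖coeff f n‖ ^ 2 + 2 * ‖coeff g n‖ ^ 2 := by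
    rw [coeff_sub hf.integrable hg.integrable]
    have := norm_sub_le (coeff f n) (coeff g n)
    nlinarith [norm_nonneg (coeff f n - coeff g n), sq_nonneg (‖coeff f n‖ - ‖coeff g n‖)]
  have h0 : 0 ≤ (1 + (n : ℝ) ^ 2) ^ s := by positivity
  calc sobolevTerm s (f - g) n = (1 + (n : ℝ) ^ 2) ^ s * ‖coeff (f - g) n‖ ^ 2 := rfl
    _ ≤ (1 + (n : ℝ) ^ 2) ^ s * (2 * ‖coeff f n‖ ^ 2 + 2 * ‖coeff g n‖ ^ 2) := by gcongr
    _ = _ := by simp only [sobolevTerm]; ring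

lemma MemSobolev.sub (hf : MemSobolev s f) (hg : MemSobolev s g) : MemSobolev s (f - g) :=
  ⟨hf.1.sub hg.1, ((hf.2.mul_left 2).add (hg.2.mul_left 2)).of_nonneg_of_le
    (sobolevTerm_nonneg s _) (hf.sobolevTerm_sub_le hg)⟩

lemma sq_sobolevNorm (s : ℝ) (f : Torus → ℝ) :
    sobolevNorm s f ^ 2 = ∑' n, sobolevTerm s f n :=
  Real.sq_sqrt (tsum_nonneg (sobolevTerm_nonneg s f))

lemma MemSobolev.sq_sobolevNorm_sub_le (hf : MemSobolev s f) (hg : MemSobolev s g) :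
    sobolevNorm s (f - g) ^ 2 ≤ 2 * sobolevNorm s f ^ 2 + 2 * sobolevNorm s g ^ 2 := by
  simp only [sq_sobolevNorm, ← tsum_mul_left]
  rw [← (hf.2.mul_left 2).tsum_add (hg.2.mul_left 2)]
  exact (hf.sub hg).2.tsum_le_tsum (hf.sobolevTerm_sub_le hg) ((hf.2.mul_left 2).add (hg.2.mul_left 2))

lemma MemSobolev.norm_coeff_le (hf : MemSobolev s f) (hs : 0 ≤ s) (n : ℤ) :
    ‖coeff f n‖ ≤ sobolevNorm s f := by
  refine Real.le_sqrt_of_sq_le (le_trans ?_ (hf.2.le_tsum n fun i _ => sobolevTerm_nonneg s f i))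
  exact le_mul_of_one_le_left (by positivity)
    (Real.one_le_rpow (by nlinarith [sq_nonneg (n : ℝ)]) hs)

/-- Differentiation multiplies `f̂(n)` by `2πin`, and `n² ≤ 1 + n²` is absorbed by one power of the
weight. -/
lemma sobolevTerm_dx_le (hf : IsCk 1 f) (s : ℝ) (n : ℤ) :
    sobolevTerm (s - 1) (dx f) n ≤ (2 * Real.pi) ^ 2 * sobolevTerm s f n := by
  have h : ‖coeff (dx f) n‖ ^ 2 = (2 * Real.pi) ^ 2 * (n : ℝ) ^ 2 * ‖coeff f n‖ ^ 2 := by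
    rw [coeff_dx hf]
    simp only [norm_mul, Complex.norm_I, Complex.norm_real, Complex.norm_intCast, mul_pow,
      Complex.norm_ofNat, Real.norm_eq_abs, sq_abs]
    ring
  have h0 : 0 ≤ (1 + (n : ℝ) ^ 2) ^ (s - 1) := by positivity
  calc sobolevTerm (s - 1) (dx f) n
      = (1 + (n : ℝ) ^ 2) ^ (s - 1) * ‖coeff (dx f) n‖ ^ 2 := rfl
    _ = (2 * Real.pi) ^ 2 * ((1 + (n : ℝ) ^ 2) ^ (s - 1) * (n : ℝ) ^ 2 * ‖coeff f n‖ ^ 2) := by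
      rw [h]; ring
    _ ≤ (2 * Real.pi) ^ 2 *
        ((1 + (n : ℝ) ^ 2) ^ (s - 1) * (1 + (n : ℝ) ^ 2) * ‖coeff f n‖ ^ 2) := by
      gcongr; linarith
    _ = _ := by
      rw [← Real.rpow_add_one (one_add_sq_pos n).ne', sub_add_cancel]; rfl

lemma summable_sobolevTerm_dx (hf : IsCk 1 f) (h : Summable (sobolevTerm s f)) :
    Summable (sobolevTerm (s - 1) (dx f)) :=
  (h.mul_left _).of_nonneg_of_le (sobolevTerm_nonneg _ _) (sobolevTerm_dx_le hf s)

lemma sobolevNorm_dx_le (hf : IsCk 1 f) (h : Summable (sobolevTerm s f)) :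
    sobolevNorm (s - 1) (dx f) ≤ 2 * Real.pi * sobolevNorm s f := by
  refine Real.sqrt_le_iff.2 ⟨by have := sobolevNorm_nonneg s f; positivity, ?_⟩
  rw [mul_pow, sq_sobolevNorm, ← tsum_mul_left]
  exact (summable_sobolevTerm_dx hf h).tsum_le_tsum (sobolevTerm_dx_le hf s) (h.mul_left _)

lemma exists_abs_dx_le_sobolevNorm (hs : 2 < s) :
    ∃ C : ℝ, 0 ≤ C ∧ ∀ f : Torus → ℝ, IsCk 1 f → Summable (sobolevTerm s f) →
      ∀ x, |dx f x| ≤ C * sobolevNorm s f := by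
  obtain ⟨C, hC, h⟩ := exists_abs_le_sobolevNorm (s := s - 1) (by linarith)
  refine ⟨C * (2 * Real.pi), by positivity, fun f hf hsum x => ?_⟩
  refine (h _ (hf.dx (k := 0) (by simp)).continuous (summable_sobolevTerm_dx hf hsum) x).trans ?_
  rw [mul_assoc]
  exact mul_le_mul_of_nonneg_left (sobolevNorm_dx_le hf hsum) hC

lemma exists_abs_dx_dx_le_sobolevNorm (hs : 3 < s) :
    ∃ C : ℝ, 0 ≤ C ∧ ∀ f : Torus → ℝ, IsCk 2 f → Summable (sobolevTerm s f) →
      ∀ x, |dx (dx f) x| ≤ C * sobolevNorm s f := by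
  obtain ⟨C, hC, h⟩ := exists_abs_dx_le_sobolevNorm (s := s - 1) (by linarith)
  refine ⟨C * (2 * Real.pi), by positivity, fun f hf hsum x => ?_⟩
  have hf1 : IsCk 1 f := ContDiff.of_le hf one_le_two
  refine (h _ (hf.dx (k := 1) (by rw [one_add_one_eq_two])) (summable_sobolevTerm_dx hf1 hsum) x).trans ?_
  rw [mul_assoc]
  exact mul_le_mul_of_nonneg_left (sobolevNorm_dx_le hf1 hsum) hC

end MFG

/-! ### Rigidity and the explicit solution -/

namespace MFG

/-- A periodic flow of zero divergence and positive density, whose velocity `u_x + b` has zero mean,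
is at rest. -/
lemma eq_neg_of_hasDerivAt_flux_zero {u v m b : Torus → ℝ} (hb : Continuous b)
    (hb0 : ∫ x : Torus, b x = 0) (hu : ∀ t : ℝ, HasDerivAt (periodicLift u) (v t) t)
    (hm : ∀ x, 0 < m x)
    (hc : ∀ t : ℝ, HasDerivAt (periodicLift fun x => m x * (v x + b x)) 0 t) (x : Torus) :
    v x = -b x := by
  have hbc : Continuous fun t : ℝ => b (t : Torus) := hb.comp (AddCircle.continuous_mk' _)
  have hB : ∀ t : ℝ, HasDerivAt (fun t : ℝ => periodicLift u t + ∫ y in (0 : ℝ)..t, b (y : Torus))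
      (v t + b t) t := fun t =>
    (hu t).add (intervalIntegral.integral_hasDerivAt_right (hbc.intervalIntegrable _ _)
      (hbc.stronglyMeasurableAtFilter _ _) hbc.continuousAt)
  -- Rolle's theorem on `[0, 1]`: the primitive of `v + b` has equal end values because `u` is
  -- periodic and `b` has mean zero. The constant flux therefore vanishes at `c`.
  obtain ⟨c, -, hc0⟩ := exists_hasDerivAt_eq_zero (zero_lt_one' ℝ)
    (continuous_iff_continuousAt.2 fun t => (hB t).continuousAt).continuousOn (by
      have h1 := UnitAddCircle.intervalIntegral_preimage 0 b
      rw [zero_add, hb0] at h1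
      have h2 := periodic_periodicLift u 0
      rw [zero_add] at h2
      simp [h1, h2]) fun t _ => hB t
  induction x using QuotientAddGroup.induction_on with
  | H t =>
    have h := is_const_of_deriv_eq_zero (fun t => (hc t).differentiableAt)
      (fun t => (hc t).deriv) t c
    simp only [periodicLift, hc0, mul_zero] at h
    have := (mul_eq_zero.1 h).resolve_left (hm _).ne'
    exact eq_neg_of_add_eq_zero_left this

lemma exists_eq_add_const_of_hasDerivAt {u v d : Torus → ℝ}
    (hu : ∀ t : ℝ, HasDerivAt (periodicLift u) (d t) t)
    (hv : ∀ t : ℝ, HasDerivAt (periodicLift v) (d t) t) : ∃ a : ℝ, ∀ x, u x = v x + a := by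
  refine ⟨u 0 - v 0, fun x => ?_⟩
  induction x using QuotientAddGroup.induction_on with
  | H t =>
    have h := is_const_of_deriv_eq_zero (f := periodicLift u - periodicLift v)
      (fun t => ((hu t).sub (hv t)).differentiableAt)
      (fun t => (((hu t).sub (hv t)).deriv).trans (sub_self _)) t 0
    simp only [Pi.sub_apply, periodicLift] at h
    change u (t : Torus) = v (t : Torus) + (u ((0 : ℝ) : Torus) - v ((0 : ℝ) : Torus))
    linarith

section Solution

variable {V b u m : Torus → ℝ} {H : ℝ}

lemma IsMFGSolution.dx_eq (h : IsMFGSolution V b u m H) (hb : IsCk ∞ b)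
    (hb0 : ∫ x : Torus, b x = 0) (x : Torus) : dx u x = -b x := by
  have hdu : IsCk ∞ (dx u) := h.smooth_u.dx (by simp)
  refine eq_neg_of_hasDerivAt_flux_zero hb.continuous hb0
    (fun t => h.smooth_u.hasDerivAt (by simp) t) h.pos (fun t => ?_) x
  have hflux : IsCk ∞ fun y => m y * (dx u y + b y) := h.smooth_m.mul (hdu.add hb)
  have := hflux.hasDerivAt (by simp) t
  rwa [neg_eq_zero.1 (h.continuity t)] at this

lemma IsMFGSolution.density_eq (h : IsMFGSolution V b u m H) (hb : IsCk ∞ b)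
    (hb0 : ∫ x : Torus, b x = 0) (x : Torus) : m x = Real.exp (V x - b x ^ 2 / 2 - H) := by
  have h1 := h.hamilton_jacobi x
  rw [h.dx_eq hb hb0] at h1
  rw [← Real.exp_log (h.pos x)]
  congr 1
  linarith

lemma IsMFGSolution.exp_eq (h : IsMFGSolution V b u m H) (hb : IsCk ∞ b)
    (hb0 : ∫ x : Torus, b x = 0) :
    Real.exp H = ∫ y : Torus, Real.exp (V y - b y ^ 2 / 2) := by
  have h1 := h.mass
  simp only [h.density_eq hb hb0, Real.exp_sub _ H, integral_div] at h1
  rwa [div_eq_one_iff_eq (Real.exp_pos H).ne', eq_comm] at h1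

lemma IsMFGSolution.eq_integral (h : IsMFGSolution V b u m H) (hb : IsCk ∞ b)
    (hb0 : ∫ x : Torus, b x = 0) (x : ℝ) :
    u (x : Torus) = -(∫ y in (0 : ℝ)..x, b (y : Torus)) +
      ∫ z in (0 : ℝ)..1, ∫ y in (0 : ℝ)..z, b (y : Torus) := by
  have hbc : Continuous fun t : ℝ => b (t : Torus) :=
    hb.continuous.comp (AddCircle.continuous_mk' _)
  have key : ∀ z : ℝ, u (z : Torus) = -(∫ y in (0 : ℝ)..z, b (y : Torus)) + u 0 := fun z => by
    have := intervalIntegral.integral_eq_sub_of_hasDerivAt (a := 0) (b := z)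
      (fun t _ => h.smooth_u.hasDerivAt (by simp) t) (by
        simp only [h.dx_eq hb hb0]; exact hbc.neg.intervalIntegrable _ _)
    simp only [h.dx_eq hb hb0, intervalIntegral.integral_neg, periodicLift] at this
    rw [this, QuotientAddGroup.mk_zero]
    ring
  have hP : Continuous fun z : ℝ => ∫ y in (0 : ℝ)..z, b (y : Torus) :=
    intervalIntegral.continuous_primitive (fun _ _ => hbc.intervalIntegrable _ _) 0
  have hPn : Continuous fun z : ℝ => -∫ y in (0 : ℝ)..z, b (y : Torus) := hP.neg
  -- The zero mean determines the integration constant `u 0`.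
  have h0 := h.mean
  rw [← UnitAddCircle.intervalIntegral_preimage 0 u, zero_add] at h0
  simp only [key] at h0
  rw [intervalIntegral.integral_add (hPn.intervalIntegrable _ _) (by simp),
    intervalIntegral.integral_neg] at h0
  simp only [intervalIntegral.integral_const, sub_zero, one_smul] at h0
  rw [key x]
  linarith

end Solution

end MFG

/-! ### From Sobolev convergence to uniform convergence of derivatives -/

namespace MFG

variable {f : ℕ → Torus → ℝ} {g : Torus → ℝ} {s : ℝ}

lemma exists_tendstoUniformly {F : ℕ → Torus → ℝ} (hF : ∀ k, Continuous (F k)) {a : ℕ → ℝ}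
    (ha : Tendsto a atTop (𝓝 0)) (h : ∀ k l x, |F k x - F l x| ≤ a k + a l) :
    ∃ G : Torus → ℝ, Continuous G ∧ TendstoUniformly F G atTop := by
  have ha0 : ∀ k, 0 ≤ a k := fun k => by
    have := h k k 0
    rw [sub_self, abs_zero] at this
    linarith
  have hc : CauchySeq fun k => (⟨F k, hF k⟩ : C(Torus, ℝ)) := by
    refine Metric.cauchySeq_iff.2 fun ε hε => ?_
    obtain ⟨N, hN⟩ := eventually_atTop.1 (ha.eventually (gt_mem_nhds (half_pos hε)))
    refine ⟨N, fun k hk l hl => ?_⟩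
    refine ((ContinuousMap.dist_le (add_nonneg (ha0 k) (ha0 l))).2 (h k l)).trans_lt ?_
    linarith [hN k hk, hN l hl]
  obtain ⟨G, hG⟩ := cauchySeq_tendsto_of_complete hc
  exact ⟨G, G.continuous, ContinuousMap.tendsto_iff_tendstoUniformly.1 hG⟩

/-- Since `2x² + 2y² ≤ (2x + 2y)²` for `x, y ≥ 0`, the bound on squares suffices; the factor 2 is
harmless for the Cauchy property. -/
lemma TendstoSobolev.sobolevNorm_sub_le (h : TendstoSobolev s f g) (k l : ℕ) :
    sobolevNorm s (f k - f l) ≤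
      2 * sobolevNorm s (fun x => f k x - g x) + 2 * sobolevNorm s (fun x => f l x - g x) := by
  have h1 := ((h.1 k).sub h.2.1).sq_sobolevNorm_sub_le ((h.1 l).sub h.2.1)
  rw [sub_sub_sub_cancel_right] at h1
  change _ ≤ 2 * sobolevNorm s (f k - g) + 2 * sobolevNorm s (f l - g)
  have h2 := sobolevNorm_nonneg s (f k - g)
  have h3 := sobolevNorm_nonneg s (f l - g)
  exact abs_le_of_sq_le_sq' (by nlinarith [mul_nonneg h2 h3]) (by positivity) |>.2

/-- Used with `D` the identity, `dx` and `dx ∘ dx`. The Sobolev limit `g` may be an irregular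
representative, so `D g` is avoided: the uniform limit comes from the Cauchy property. -/
lemma TendstoSobolev.exists_tendstoUniformly (h : TendstoSobolev s f g) {D : (Torus → ℝ) → Torus → ℝ}
    (hD : ∀ k, Continuous (D (f k))) (hsub : ∀ k l, D (f k - f l) = D (f k) - D (f l)) {C : ℝ}
    (hC : ∀ k l x, |D (f k - f l) x| ≤ C * sobolevNorm s (f k - f l)) (hC0 : 0 ≤ C) :
    ∃ G : Torus → ℝ, Continuous G ∧ TendstoUniformly (fun k => D (f k)) G atTop := by
  refine MFG.exists_tendstoUniformly hD
    (a := fun k => C * (2 * sobolevNorm s (fun x => f k x - g x))) ?_ fun k l x => ?_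
  · simpa using (h.2.2.const_mul 2).const_mul C
  · have := hC k l x
    rw [hsub, Pi.sub_apply] at this
    rw [← mul_add]
    exact this.trans (mul_le_mul_of_nonneg_left (h.sobolevNorm_sub_le k l) hC0)

lemma tendsto_coeff_of_tendstoUniformly {G : Torus → ℝ} (hf : ∀ k, Continuous (f k))
    (hG : Continuous G) (h : TendstoUniformly f G atTop) (n : ℤ) :
    Tendsto (fun k => coeff (f k) n) atTop (𝓝 (coeff G n)) := by
  refine Metric.tendsto_nhds.2 fun ε hε => ?_
  filter_upwards [Metric.tendstoUniformly_iff.1 h (ε / 2) (half_pos hε)] with k hk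
  have hi : ∀ {F : Torus → ℝ}, Continuous F → Integrable F := fun hF =>
    hF.integrable_of_hasCompactSupport (HasCompactSupport.of_compactSpace _)
  rw [dist_eq_norm, ← coeff_sub (hi (hf k)) (hi hG)]
  refine (norm_coeff_le (C := ε / 2) (fun x => ?_) n).trans_lt (half_lt_self hε)
  have := (hk x).le
  rwa [dist_comm, Real.dist_eq] at this

/-- A uniform limit coincides with the limit in the Sobolev space. -/
lemma TendstoSobolev.congr_limit {G : Torus → ℝ} (h : TendstoSobolev s f g) (hs : 0 ≤ s)
    (hf : ∀ k, Continuous (f k)) (hG : Continuous G) (hGs : MemSobolev s G)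
    (hfG : TendstoUniformly f G atTop) : TendstoSobolev s f G := by
  -- Both modes of convergence pass to Fourier coefficients, and `sobolevNorm` depends on nothing
  -- else.
  have hcoeff : ∀ n, coeff G n = coeff g n := fun n => by
    refine tendsto_nhds_unique (tendsto_coeff_of_tendstoUniformly hf hG hfG n) ?_
    refine tendsto_iff_norm_sub_tendsto_zero.2 (squeeze_zero (fun _ => norm_nonneg _)
      (fun k => ?_) h.2.2)
    rw [← coeff_sub (h.1 k).integrable h.2.1.integrable]
    exact ((h.1 k).sub h.2.1).norm_coeff_le hs n
  refine ⟨h.1, hGs, h.2.2.congr fun k => ?_⟩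
  unfold sobolevNorm
  congr 2
  ext n
  change (1 + (n : ℝ) ^ 2) ^ s * ‖coeff (f k - g) n‖ ^ 2 =
    (1 + (n : ℝ) ^ 2) ^ s * ‖coeff (f k - G) n‖ ^ 2
  rw [coeff_sub (h.1 k).integrable h.2.1.integrable, coeff_sub (h.1 k).integrable hGs.integrable,
    hcoeff]

lemma hasDerivAt_of_tendstoUniformly_dx {G G' : Torus → ℝ} (hf : ∀ k, IsCk 1 (f k))
    (h : TendstoUniformly f G atTop) (h' : TendstoUniformly (fun k => dx (f k)) G' atTop) (t : ℝ) :
    HasDerivAt (periodicLift G) (G' t) t :=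
  hasDerivAt_of_tendstoUniformly (h'.comp ((↑) : ℝ → Torus))
    (Eventually.of_forall fun k t => (hf k).hasDerivAt one_ne_zero t)
    (fun t => h.tendsto_at (t : Torus)) t

lemma TendstoSobolev.exists_tendstoUniformly_C1 (h : TendstoSobolev s f g) (hs : 2 < s)
    (hf : ∀ k, IsCk 1 (f k)) :
    ∃ G G₁ : Torus → ℝ, Continuous G ∧ Continuous G₁ ∧ TendstoUniformly f G atTop ∧
      TendstoUniformly (fun k => dx (f k)) G₁ atTop ∧
      ∀ t : ℝ, HasDerivAt (periodicLift G) (G₁ t) t := by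
  obtain ⟨C, hC0, hC⟩ := exists_abs_le_sobolevNorm (s := s) (by linarith)
  obtain ⟨C', hC0', hC'⟩ := exists_abs_dx_le_sobolevNorm hs
  have hsub : ∀ k l, IsCk 1 (f k - f l) := fun k l => (hf k).sub (hf l)
  have hmem : ∀ k l, Summable (sobolevTerm s (f k - f l)) := fun k l => ((h.1 k).sub (h.1 l)).2
  obtain ⟨G, hG, hfG⟩ := h.exists_tendstoUniformly (D := id) (fun k => (hf k).continuous)
    (fun _ _ => rfl) (fun k l => hC _ (hsub k l).continuous (hmem k l)) hC0
  obtain ⟨G₁, hG₁, hfG₁⟩ := h.exists_tendstoUniformly (D := dx)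
    (fun k => ((hf k).dx (k := 0) (by simp)).continuous)
    (fun k l => dx_sub (hf k) (hf l) one_ne_zero) (fun k l => hC' _ (hsub k l) (hmem k l)) hC0'
  exact ⟨G, G₁, hG, hG₁, hfG, hfG₁, hasDerivAt_of_tendstoUniformly_dx hf hfG hfG₁⟩

lemma TendstoSobolev.exists_tendstoUniformly_C2 (h : TendstoSobolev s f g) (hs : 3 < s)
    (hf : ∀ k, IsCk 2 (f k)) :
    ∃ G G₁ G₂ : Torus → ℝ, Continuous G ∧ Continuous G₁ ∧ Continuous G₂ ∧
      TendstoUniformly f G atTop ∧ TendstoUniformly (fun k => dx (f k)) G₁ atTop ∧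
      TendstoUniformly (fun k => dx (dx (f k))) G₂ atTop ∧
      (∀ t : ℝ, HasDerivAt (periodicLift G) (G₁ t) t) ∧
      ∀ t : ℝ, HasDerivAt (periodicLift G₁) (G₂ t) t := by
  have hf1 : ∀ k, IsCk 1 (f k) := fun k => ContDiff.of_le (hf k) one_le_two
  have hdf : ∀ k, IsCk 1 (dx (f k)) := fun k => (hf k).dx (by rw [one_add_one_eq_two])
  obtain ⟨G, G₁, hG, hG₁, hfG, hfG₁, hd⟩ := h.exists_tendstoUniformly_C1 (by linarith) hf1
  obtain ⟨C, hC0, hC⟩ := exists_abs_dx_dx_le_sobolevNorm hs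
  obtain ⟨G₂, hG₂, hfG₂⟩ := h.exists_tendstoUniformly (D := fun u => dx (dx u))
    (fun k => ((hdf k).dx (k := 0) (by simp)).continuous)
    (fun k l => by
      rw [dx_sub (hf1 k) (hf1 l) one_ne_zero, dx_sub (hdf k) (hdf l) one_ne_zero])
    (fun k l => hC _ ((hf k).sub (hf l)) ((h.1 k).sub (h.1 l)).2) hC0
  exact ⟨G, G₁, G₂, hG, hG₁, hG₂, hfG, hfG₁, hfG₂, hd,
    hasDerivAt_of_tendstoUniformly_dx hdf hfG₁ hfG₂⟩

end MFG

/-! ### Sample points and identification of the limit -/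

namespace MFG

lemma exists_dist_le_fillDistance {M : ℕ} (hM : 0 < M) (X : Fin M → Torus) (x : Torus) :
    ∃ i, dist x (X i) ≤ fillDistance X := by
  have : Nonempty (Fin M) := ⟨⟨0, hM⟩⟩
  obtain ⟨i, hi⟩ := exists_eq_ciInf_of_finite (f := fun i => dist x (X i))
  refine ⟨i, hi.trans_le (le_ciSup (f := fun x => ⨅ i, dist x (X i)) ?_ x)⟩
  -- A real supremum bounds its family only if the family is bounded above; compactness of the torus
  -- provides this.
  refine ⟨Metric.diam (Set.univ : Set Torus), ?_⟩
  rintro _ ⟨y, rfl⟩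
  exact (ciInf_le (Set.finite_range _).bddBelow i).trans
    (Metric.dist_le_diam_of_mem isCompact_univ.isBounded (Set.mem_univ _) (Set.mem_univ _))

lemma sampleMean_const_mul {M : ℕ} (X : Fin M → Torus) (c : ℝ) (f : Torus → ℝ) :
    sampleMean X (fun x => c * f x) = c * sampleMean X f := by
  simp only [sampleMean, ← Finset.mul_sum]; ring

lemma sampleMean_add_const {M : ℕ} (hM : 0 < M) (X : Fin M → Torus) (f : Torus → ℝ) (a : ℝ) :
    sampleMean X (fun x => f x + a) = sampleMean X f + a := by
  have : (M : ℝ) ≠ 0 := by positivity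
  simp only [sampleMean, Finset.sum_add_distrib, Finset.sum_const, Finset.card_univ,
    Fintype.card_fin, nsmul_eq_mul]
  field_simp

lemma abs_sampleMean_sub_le {M : ℕ} (hM : 0 < M) (X : Fin M → Torus) {f g : Torus → ℝ} {ε : ℝ}
    (h : ∀ x, |f x - g x| ≤ ε) : |sampleMean X f - sampleMean X g| ≤ ε := by
  have hM' : (0 : ℝ) < M := by positivity
  rw [sampleMean, sampleMean, ← mul_sub, ← Finset.sum_sub_distrib, abs_mul,
    abs_of_pos (by positivity), one_div, inv_mul_le_iff₀ hM']
  refine (Finset.abs_sum_le_sum_abs _ _).trans ((Finset.sum_le_card_nsmul _ _ ε fun i _ => h _).trans ?_)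
  simp

/-- Averages contract the sup norm whatever the sample, so the points may change with `k`. -/
lemma tendsto_sampleMean_sub {M : ℕ → ℕ} (hM : ∀ k, 0 < M k) (X : ∀ k, Fin (M k) → Torus)
    {f : ℕ → Torus → ℝ} {g : Torus → ℝ} (h : TendstoUniformly f g atTop) :
    Tendsto (fun k => sampleMean (X k) (f k) - sampleMean (X k) g) atTop (𝓝 0) := by
  refine Metric.tendsto_nhds.2 fun ε hε => ?_
  filter_upwards [Metric.tendstoUniformly_iff.1 h (ε / 2) (half_pos hε)] with k hk
  rw [Real.dist_eq, sub_zero]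
  refine (abs_sampleMean_sub_le (hM k) (X k) (ε := ε / 2) fun x => ?_).trans_lt (half_lt_self hε)
  have := (hk x).le
  rwa [dist_comm, Real.dist_eq] at this

/-- A `C² × C¹` limit of functions that solve the mean field game at sample points of vanishing fill
distance, with the sample means of the solution, is the solution. -/
lemma IsMFGSolution.eq_of_tendsto {V b uS mS : Torus → ℝ} {HS : ℝ}
    (hsol : IsMFGSolution V b uS mS HS) (hV : IsCk ∞ V) (hb : IsCk ∞ b)
    (hb0 : ∫ x : Torus, b x = 0) {M : ℕ → ℕ} (hM : ∀ k, 0 < M k) (X : ∀ k, Fin (M k) → Torus)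
    (hfill : Tendsto (fun k => fillDistance (X k)) atTop (𝓝 0))
    (hXu : Tendsto (fun k => sampleMean (X k) uS) atTop (𝓝 0))
    (hXm : Tendsto (fun k => sampleMean (X k) mS) atTop (𝓝 1))
    {u m : ℕ → Torus → ℝ} {H : ℕ → ℝ}
    (hpos : ∀ k i, 0 < m k (X k i))
    (hHJ : ∀ k i, hamiltonian V b (X k i) (dx (u k) (X k i)) = Real.log (m k (X k i)) + H k)
    (hcont : ∀ k i, dx (m k) (X k i) * (dx (u k) (X k i) + b (X k i)) +
      m k (X k i) * (dx (dx (u k)) (X k i) + dx b (X k i)) = 0)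
    (hu0 : Tendsto (fun k => sampleMean (X k) (u k)) atTop (𝓝 0))
    (hm1 : Tendsto (fun k => sampleMean (X k) (m k)) atTop (𝓝 1))
    {G G₁ G₂ F F₁ : Torus → ℝ} {h : ℝ} (hG₁ : Continuous G₁) (hG₂ : Continuous G₂)
    (hF : Continuous F) (hF₁ : Continuous F₁)
    (huG : TendstoUniformly u G atTop) (huG₁ : TendstoUniformly (fun k => dx (u k)) G₁ atTop)
    (huG₂ : TendstoUniformly (fun k => dx (dx (u k))) G₂ atTop)
    (hGd : ∀ t : ℝ, HasDerivAt (periodicLift G) (G₁ t) t)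
    (hG₁d : ∀ t : ℝ, HasDerivAt (periodicLift G₁) (G₂ t) t)
    (hmF : TendstoUniformly m F atTop) (hmF₁ : TendstoUniformly (fun k => dx (m k)) F₁ atTop)
    (hFd : ∀ t : ℝ, HasDerivAt (periodicLift F) (F₁ t) t) (hH : Tendsto H atTop (𝓝 h)) :
    G = uS ∧ F = mS ∧ h = HS := by
  have hVc := hV.continuous
  have hbc := hb.continuous
  have hdb : Continuous (dx b) := (hb.dx (k := 0) (by simp)).continuous
  have hlim : ∀ x, F x = Real.exp (V x + G₁ x ^ 2 / 2 + b x * G₁ x - h) ∧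
      F₁ x * (G₁ x + b x) + F x * (G₂ x + dx b x) = 0 := fun x => by
    choose i hi using fun k => exists_dist_le_fillDistance (hM k) (X k) x
    have hy : Tendsto (fun k => X k (i k)) atTop (𝓝 x) := by
      rw [tendsto_iff_dist_tendsto_zero]
      exact squeeze_zero (fun _ => dist_nonneg) (fun k => (dist_comm _ _).trans_le (hi k)) hfill
    have e0 := hmF.tendsto_comp hF.continuousAt hy
    have e1 := hmF₁.tendsto_comp hF₁.continuousAt hy
    have d1 := huG₁.tendsto_comp hG₁.continuousAt hy
    have d2 := huG₂.tendsto_comp hG₂.continuousAt hy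
    have v0 := (hVc.tendsto x).comp hy
    have b0 := (hbc.tendsto x).comp hy
    have b1 := (hdb.tendsto x).comp hy
    constructor
    -- The Hamilton-Jacobi equation is solved for the density before passing to the limit. This
    -- avoids the logarithm near 0 and makes the limit density positive.
    · refine tendsto_nhds_unique e0 (((Real.continuous_exp.tendsto _).comp
        (((v0.add ((d1.pow 2).div_const 2)).add (b0.mul d1)).sub hH)).congr fun k => ?_)
      have := hHJ k (i k)
      simp only [hamiltonian] at this
      simp only [Function.comp_apply]
      rw [this, add_sub_cancel_right, Real.exp_log (hpos k (i k))]
    · refine tendsto_nhds_unique ((e1.mul (d1.add b0)).add (e0.mul (d2.add b1)))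
        (tendsto_const_nhds.congr fun k => (hcont k (i k)).symm)
  have hFpos : ∀ x, 0 < F x := fun x => by rw [(hlim x).1]; exact Real.exp_pos _
  -- The limit of the expanded continuity equation is the product rule for the flux `F (G₁ + b)`.
  have hG₁b : ∀ x, G₁ x = -b x := eq_neg_of_hasDerivAt_flux_zero hbc hb0 hGd hFpos fun t => by
    have := (hFd t).mul ((hG₁d t).add (hb.hasDerivAt (by simp) t))
    exact this.congr_deriv (hlim t).2
  obtain ⟨a, ha⟩ := exists_eq_add_const_of_hasDerivAt (u := G) (v := uS) (d := G₁) hGd fun t => by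
    have := hsol.smooth_u.hasDerivAt (by simp) t
    rwa [hsol.dx_eq hb hb0, ← hG₁b] at this
  have hFm : F = fun x => Real.exp (HS - h) * mS x := by
    ext x
    rw [(hlim x).1, hG₁b, hsol.density_eq hb hb0, ← Real.exp_add]
    congr 1
    ring
  -- The sample means of `uS + a` tend to `a`, and to 0 because `u k → G` uniformly. The factor `exp
  -- (HS - h)` is found likewise.
  have ha0 : a = 0 := by
    have h1 := hu0.sub (tendsto_sampleMean_sub hM X huG)
    simp only [sub_sub_cancel, sub_self] at h1
    rw [show G = fun x => uS x + a from funext ha] at h1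
    simp only [sampleMean_add_const (hM _)] at h1
    simpa using tendsto_nhds_unique (hXu.add_const a) h1
  have hk1 : Real.exp (HS - h) = 1 := by
    have h1 := hm1.sub (tendsto_sampleMean_sub hM X hmF)
    simp only [sub_sub_cancel, sub_zero] at h1
    rw [hFm] at h1
    simp only [sampleMean_const_mul] at h1
    simpa using tendsto_nhds_unique (hXm.const_mul _) h1
  refine ⟨funext fun x => by rw [ha, ha0, add_zero], ?_, ?_⟩
  · simp only [hFm, hk1, one_mul]
  · rw [Real.exp_eq_one_iff] at hk1
    linarith

end MFG

/-! ### Compactness and bounds for minimizers -/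

namespace MFG

variable {U W : Type*} [NormedAddCommGroup U] [InnerProductSpace ℝ U] [RKHS ℝ U Torus ℝ]
  [NormedAddCommGroup W] [InnerProductSpace ℝ W] [RKHS ℝ W Torus ℝ]

lemma TendstoSobolev.comp {s : ℝ} {f : ℕ → Torus → ℝ} {g : Torus → ℝ} (h : TendstoSobolev s f g)
    {φ : ℕ → ℕ} (hφ : Tendsto φ atTop atTop) : TendstoSobolev s (fun k => f (φ k)) g :=
  ⟨fun _ => h.1 _, h.2.1, h.2.2.comp hφ⟩

lemma TendstoSobolev.mono {s t : ℝ} {f : ℕ → Torus → ℝ} {g : Torus → ℝ} (h : TendstoSobolev s f g)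
    (hts : t ≤ s) : TendstoSobolev t f g :=
  ⟨fun k => (h.1 k).mono hts, h.2.1.mono hts, squeeze_zero (fun _ => sobolevNorm_nonneg _ _)
    (fun k => ((h.1 k).sub h.2.1).sobolevNorm_mono hts) h.2.2⟩

lemma TendstoSobolev.tendsto_apply {s : ℝ} {f : ℕ → Torus → ℝ} {g : Torus → ℝ}
    (h : TendstoSobolev s f g) (hs : 1 < s) (hf : ∀ k, Continuous (f k)) (hg : Continuous g)
    (x : Torus) : Tendsto (fun k => f k x) atTop (𝓝 (g x)) := by
  obtain ⟨C, -, hC⟩ := exists_abs_le_sobolevNorm hs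
  refine tendsto_iff_norm_sub_tendsto_zero.2 (squeeze_zero (fun _ => norm_nonneg _)
    (fun k => hC (f k - g) ((hf k).sub hg) ((h.1 k).sub h.2.1).2 x) ?_)
  have h1 := h.2.2.const_mul C
  rwa [mul_zero] at h1

/-- The solution is thus a competitor for every sample. Both terms of the continuity constraint
vanish, as `u_x = -b` and `u_xx = -b_x`. -/
lemma IsMFGSolution.mem_gpFeasible {V b : Torus → ℝ} {u : U} {m : W} {H : ℝ}
    (h : IsMFGSolution V b u m H) (hb : IsCk ∞ b) (hb0 : ∫ x : Torus, b x = 0) {M : ℕ}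
    (X : Fin M → Torus) : (u, m, H) ∈ gpFeasible U W V b X := fun i => by
  have hu : dx u = fun x => -b x := funext (h.dx_eq hb hb0)
  refine ⟨h.pos _, ?_, ?_⟩
  · rw [hamiltonian, ← h.hamilton_jacobi]
    ring
  · have hd : dx (dx u) (X i) = -dx b (X i) := by
      rw [hu]
      induction X i using QuotientAddGroup.induction_on with
      | H t => exact dx_eq_of_hasDerivAt (hb.hasDerivAt (by simp) t).neg
    rw [hd, h.dx_eq hb hb0]
    ring

/-- Bounded feasible points with the correct sample means accumulate at the solution. -/
lemma exists_subseq_tendstoSobolev (hU : ∀ f : U, IsCk 2 f) (hW : ∀ f : W, IsCk 1 f)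
    {s₁ s₂ : ℝ} (hs₁ : 3 < s₁) (hs₂ : 2 < s₂) (hUs : CompactlyEmbedded U s₁)
    (hWs : CompactlyEmbedded W s₂) {V b : Torus → ℝ} (hV : IsCk ∞ V) (hb : IsCk ∞ b)
    (hb0 : ∫ x : Torus, b x = 0) {uS : U} {mS : W} {HS : ℝ} (hsol : IsMFGSolution V b uS mS HS)
    {M : ℕ → ℕ} (hM : ∀ k, 0 < M k) (X : ∀ k, Fin (M k) → Torus)
    (hfill : Tendsto (fun k => fillDistance (X k)) atTop (𝓝 0))
    (hXu : Tendsto (fun k => sampleMean (X k) uS) atTop (𝓝 0))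
    (hXm : Tendsto (fun k => sampleMean (X k) mS) atTop (𝓝 1))
    {u : ℕ → U} {m : ℕ → W} {H : ℕ → ℝ} {C : ℝ} (hu : ∀ k, ‖u k‖ ≤ C) (hm : ∀ k, ‖m k‖ ≤ C)
    (hH : ∀ k, |H k| ≤ C) (hq : ∀ k, (u k, m k, H k) ∈ gpFeasible U W V b (X k))
    (hu0 : Tendsto (fun k => sampleMean (X k) (u k)) atTop (𝓝 0))
    (hm1 : Tendsto (fun k => sampleMean (X k) (m k)) atTop (𝓝 1)) :
    ∃ φ : ℕ → ℕ, TendstoSobolev s₁ (fun k => ⇑(u (φ k))) uS ∧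
      TendstoSobolev s₂ (fun k => ⇑(m (φ k))) mS ∧ Tendsto (fun k => H (φ k)) atTop (𝓝 HS) := by
  obtain ⟨g, φ₁, hφ₁, hg⟩ := hUs.2 u ⟨C, hu⟩
  obtain ⟨f, φ₂, hφ₂, hf⟩ := hWs.2 (fun k => m (φ₁ k)) ⟨C, fun k => hm _⟩
  obtain ⟨h, -, φ₃, hφ₃, hh⟩ := tendsto_subseq_of_bounded
    (Metric.isBounded_closedBall (x := (0 : ℝ)) (r := C)) (x := fun k => H (φ₁ (φ₂ k)))
    fun k => by simpa using hH _
  have hφ : Tendsto (fun k => φ₁ (φ₂ (φ₃ k))) atTop atTop :=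
    hφ₁.tendsto_atTop.comp (hφ₂.tendsto_atTop.comp hφ₃.tendsto_atTop)
  have hg' := hg.comp (hφ₂.tendsto_atTop.comp hφ₃.tendsto_atTop)
  have hf' := hf.comp hφ₃.tendsto_atTop
  obtain ⟨G, G₁, G₂, hGc, hG₁c, hG₂c, hG, hG₁, hG₂, hGd, hG₁d⟩ :=
    hg'.exists_tendstoUniformly_C2 hs₁ fun k => hU _
  obtain ⟨F, F₁, hFc, hF₁c, hF, hF₁, hFd⟩ := hf'.exists_tendstoUniformly_C1 hs₂ fun k => hW _
  -- The uniform limits are the solution; `congr_limit` then puts it in place of the abstract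
  -- Sobolev limits.
  obtain ⟨rfl, rfl, rfl⟩ := hsol.eq_of_tendsto hV hb hb0
    (X := fun k => X (φ₁ (φ₂ (φ₃ k)))) (fun k => hM _)
    (hfill.comp hφ) (hXu.comp hφ) (hXm.comp hφ) (fun k i => (hq _ i).1) (fun k i => (hq _ i).2.1)
    (fun k i => (hq _ i).2.2) (hu0.comp hφ) (hm1.comp hφ) hG₁c hG₂c hFc hF₁c hG hG₁ hG₂ hGd hG₁d
    hF hF₁ hFd hh
  exact ⟨fun k => φ₁ (φ₂ (φ₃ k)),
    hg'.congr_limit (by linarith) (fun k => (hU _).continuous) hGc (hUs.1 uS) hG,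
    hf'.congr_limit (by linarith) (fun k => (hW _).continuous) hFc (hWs.1 mS) hF, hh⟩

/-- The minimizers are bounded, and their sample means are asymptotically correct. -/
lemma IsGPMinimizer.bounds {V b : Torus → ℝ} {u uS : U} {m mS : W} {H HS : ℝ} {M : ℕ}
    {X : Fin M → Torus} {β K : ℝ} (hβ : 0 < β) (h : IsGPMinimizer V b X β (u, m, H))
    (hS : (uS, mS, HS) ∈ gpFeasible U W V b X) (hK : gpObjective U W X β (uS, mS, HS) ≤ K ^ 2)
    (hK0 : 0 ≤ K) :
    ‖u‖ ≤ K ∧ ‖m‖ ≤ K ∧ |H| ≤ K ∧ |sampleMean X m - 1| ^ 2 ≤ K ^ 2 / β ∧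
      |sampleMean X u| ^ 2 ≤ K ^ 2 / β := by
  have h1 : gpObjective U W X β (u, m, H) ≤ K ^ 2 := (h.2 hS).trans hK
  simp only [gpObjective] at h1
  have n1 := sq_nonneg ‖u‖
  have n2 := sq_nonneg ‖m‖
  have n3 := sq_nonneg |H|
  have n4 := mul_nonneg hβ.le (sq_nonneg |sampleMean X m - 1|)
  have n5 := mul_nonneg hβ.le (sq_nonneg |sampleMean X u|)
  refine ⟨?_, ?_, ?_, ?_, ?_⟩
  · exact le_of_sq_le_sq (by linarith) hK0
  · exact le_of_sq_le_sq (by linarith) hK0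
  · exact le_of_sq_le_sq (by linarith) hK0
  · rw [le_div_iff₀ hβ]; linarith
  · rw [le_div_iff₀ hβ]; linarith

lemma tendsto_zero_of_sq_abs_le {β : ℕ → ℝ} (hβ : Tendsto β atTop atTop) {a : ℕ → ℝ} {K : ℝ}
    (h : ∀ p, |a p| ^ 2 ≤ K / β p) : Tendsto a atTop (𝓝 0) := by
  have h1 : Tendsto (fun p => |a p| ^ 2) atTop (𝓝 0) :=
    squeeze_zero (fun _ => by positivity) h (hβ.const_div_atTop K)
  have h2 := (Real.continuous_sqrt.tendsto 0).comp h1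
  rw [Real.sqrt_zero] at h2
  refine (tendsto_zero_iff_abs_tendsto_zero a).2 ?_
  exact h2.congr fun p => Real.sqrt_sq (abs_nonneg _)

end MFG

/-! ### The main theorem -/

theorem mainTheorem4
    {U W : Type*}
    [NormedAddCommGroup U] [InnerProductSpace ℝ U] [CompleteSpace U] [RKHS ℝ U MFG.Torus ℝ]
    [NormedAddCommGroup W] [InnerProductSpace ℝ W] [CompleteSpace W] [RKHS ℝ W MFG.Torus ℝ]
    (hU : ∀ f : U, MFG.IsCk 2 f) (hW : ∀ f : W, MFG.IsCk 1 f)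
    {s₁ s₂ : ℝ} (hs₁ : 3 < s₁) (hs₂ : 2 < s₂)
    (hUs : MFG.CompactlyEmbedded U s₁) (hWs : MFG.CompactlyEmbedded W s₂)
    {V b : MFG.Torus → ℝ} (hV : MFG.IsCk ∞ V) (hb : MFG.IsCk ∞ b)
    (hb0 : ∫ x : MFG.Torus, b x = 0)
    (uStar : U) (mStar : W) (HStar : ℝ)
    (hsol : MFG.IsMFGSolution V b uStar mStar HStar)
    (X : ∀ M : ℕ, Fin M → MFG.Torus)
    (hXinj : ∀ M, Function.Injective (X M))
    (hXfill : Tendsto (fun M => MFG.fillDistance (X M)) atTop (𝓝 0))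
    (hXu : Tendsto (fun M => MFG.sampleMean (X M) uStar) atTop (𝓝 (∫ x : MFG.Torus, uStar x)))
    (hXm : Tendsto (fun M => MFG.sampleMean (X M) mStar) atTop (𝓝 (∫ x : MFG.Torus, mStar x))) :
    -- the solution is the explicit one
    ((∀ x : ℝ, uStar (x : MFG.Torus) =
        -(∫ y in (0 : ℝ)..x, b (y : MFG.Torus)) +
          ∫ z in (0 : ℝ)..1, ∫ y in (0 : ℝ)..z, b (y : MFG.Torus)) ∧
      (∀ x : MFG.Torus, mStar x =
        Real.exp (V x - b x ^ 2 / 2) / ∫ y : MFG.Torus, Real.exp (V y - b y ^ 2 / 2)) ∧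
      HStar = Real.log (∫ y : MFG.Torus, Real.exp (V y - b y ^ 2 / 2))) ∧
    -- convergence of the minimizers as the penalization and the number of samples go to infinity
    ∀ β : ℕ → ℝ, (∀ p, 0 < β p) → Tendsto β atTop atTop →
      ∃ N : ℕ → ℕ, ∀ M : ℕ → ℕ, (∀ p, N p ≤ M p) →
        ∀ (u : ℕ → U) (m : ℕ → W) (H : ℕ → ℝ),
          (∀ p, MFG.IsGPMinimizer V b (X (M p)) (β p) (u p, m p, H p)) →
          (∀ x, Tendsto (fun p => u p x) atTop (𝓝 (uStar x))) ∧
          (∀ x, Tendsto (fun p => m p x) atTop (𝓝 (mStar x))) ∧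
          Tendsto H atTop (𝓝 HStar) ∧
          ∀ t₁ ∈ Set.Ioo 3 s₁, ∀ t₂ ∈ Set.Ioo 2 s₂,
            MFG.TendstoSobolev t₁ (fun p => ⇑(u p)) uStar ∧
            MFG.TendstoSobolev t₂ (fun p => ⇑(m p)) mStar := by
  refine ⟨⟨hsol.eq_integral hb hb0, fun x => ?_, ?_⟩, fun β hβ hβlim => ?_⟩
  · rw [hsol.density_eq hb hb0, Real.exp_sub, hsol.exp_eq hb hb0]
  · rw [← hsol.exp_eq hb hb0, Real.log_exp]
  rw [hsol.mean] at hXu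
  rw [hsol.mass] at hXm
  -- `N p` is chosen after `β p`, so that the solution pays at most 1 for each penalty. The bound `p
  -- + 1 ≤ M` makes the samples nonempty and forces `M p → ∞`.
  have hN : ∀ p : ℕ, ∃ N : ℕ, ∀ M ≥ N, p + 1 ≤ M ∧
      β p * |MFG.sampleMean (X M) mStar - 1| ^ 2 ≤ 1 ∧
      β p * |MFG.sampleMean (X M) uStar| ^ 2 ≤ 1 := fun p => by
    have h1 := (((hXm.sub_const 1).abs.pow 2).const_mul (β p)).eventually_le_const
      (u := 1) (by simp)
    have h2 := ((hXu.abs.pow 2).const_mul (β p)).eventually_le_const (u := 1) (by simp)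
    exact eventually_atTop.1 ((eventually_ge_atTop (p + 1)).and (h1.and h2))
  choose N hN using hN
  refine ⟨N, fun M hM u m H hmin => ?_⟩
  have hM0 : ∀ p, 0 < M p := fun p => p.succ_pos.trans_le (hN p _ (hM p)).1
  have hMlim : Tendsto M atTop atTop :=
    tendsto_atTop_mono (fun p => p.le_succ.trans (hN p _ (hM p)).1) tendsto_id
  -- The two summands 1 bound the penalties of the solution.
  set K : ℝ := √(‖uStar‖ ^ 2 + ‖mStar‖ ^ 2 + |HStar| ^ 2 + 1 + 1) with hK
  have hK2 : K ^ 2 = ‖uStar‖ ^ 2 + ‖mStar‖ ^ 2 + |HStar| ^ 2 + 1 + 1 :=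
    Real.sq_sqrt (by positivity)
  have hbd := fun p => (hmin p).bounds (K := K) (hβ p) (hsol.mem_gpFeasible hb hb0 (X (M p))) (by
    rw [hK2]
    exact add_le_add (add_le_add le_rfl (hN p _ (hM p)).2.1) (hN p _ (hM p)).2.2)
    (Real.sqrt_nonneg _)
  have hm1 : Tendsto (fun p => MFG.sampleMean (X (M p)) (m p)) atTop (𝓝 1) := by
    simpa using (MFG.tendsto_zero_of_sq_abs_le hβlim fun p => (hbd p).2.2.2.1).add_const 1
  have hu0 := MFG.tendsto_zero_of_sq_abs_le hβlim fun p => (hbd p).2.2.2.2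
  have hconv : Tendsto (fun p => (MFG.sobolevNorm s₁ (fun x => u p x - uStar x),
      MFG.sobolevNorm s₂ (fun x => m p x - mStar x), H p)) atTop (𝓝 (0, 0, HStar)) := by
    -- Every subsequence has a further one with the same limit. Recording the Sobolev distances and
    -- `H` as one point of `ℝ × ℝ × ℝ` allows a single extraction.
    refine tendsto_of_subseq_tendsto fun ns hns => ?_
    have hMns := hMlim.comp hns
    obtain ⟨φ, h1, h2, h3⟩ := MFG.exists_subseq_tendstoSobolev hU hW hs₁ hs₂ hUs hWs hV hb hb0 hsol
      (X := fun k => X (M (ns k))) (fun k => hM0 _) (hXfill.comp hMns) (hXu.comp hMns)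
      (hXm.comp hMns) (u := fun k => u (ns k)) (m := fun k => m (ns k)) (H := fun k => H (ns k))
      (fun k => (hbd _).1) (fun k => (hbd _).2.1) (fun k => (hbd _).2.2.1)
      (fun k => (hmin _).1) (hu0.comp hns) (hm1.comp hns)
    exact ⟨φ, h1.2.2.prodMk_nhds (h2.2.2.prodMk_nhds h3)⟩
  have hus : MFG.TendstoSobolev s₁ (fun p => ⇑(u p)) uStar :=
    ⟨fun p => hUs.1 _, hUs.1 _, (continuous_fst.tendsto _).comp hconv⟩
  have hms : MFG.TendstoSobolev s₂ (fun p => ⇑(m p)) mStar :=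
    ⟨fun p => hWs.1 _, hWs.1 _, ((continuous_fst.comp continuous_snd).tendsto _).comp hconv⟩
  -- Convergence holds at the end exponents `s₁` and `s₂` themselves, which dominate all smaller
  -- ones.
  exact ⟨hus.tendsto_apply (by linarith) (fun p => (hU _).continuous) (hU _).continuous,
    hms.tendsto_apply (by linarith) (fun p => (hW _).continuous) (hW _).continuous,
    ((continuous_snd.comp continuous_snd).tendsto _).comp hconv,
    fun t₁ ht₁ t₂ ht₂ => ⟨hus.mono ht₁.2.le, hms.mono ht₂.2.le⟩⟩
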